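/- Let $r\ge 1$, let $K=\mathbb F_{2^r}$, and let $Z=\{(x,y)\in K^2: x^{2^r}=x,\ y^2=y\}=\mathbb F_{2^r}\times\mathbb F_2$ (so $N_1=2^r$, $N_2=2$, $J=\emptyset$), $n_J=\#Z$. For a set $\Delta$ of exponents, let $C_\Delta\subseteq K^{Z}$ be the span of the evaluations on $Z$ of the monomials $X^{a}Y^{b}$, $(a,b)\in\Delta$; the binary code with defining set $\Delta$ is the subfield subcode $C_\Delta\cap\mathbb F_2^{Z}$. Let $I_{(a,b)}=\{\overline{2^i(a,b)}: i\ge 0\}$ be the binary cyclotomic set of $(a,b)$, where the bar keeps zero coordinates and reduces positive coordinates modulo $2^r-1$ into $\{1,\dots,2^r-1\}$ and modulo $1$ into $\{1\}$, respectively. Write $\star$ for the componentwise product of codes, $d(\cdot)$ for the minimum distance, and $\mathrm{RM}_2(s,m)$ for the binary Reed–Muller codes. For codes $C,D\subseteq\mathbb F_2^{n}$, a Schur product PIR scheme with storage code $C$ and retrieval code $D$ is the following kind of private information retrieval scheme on $n$ servers. Every file is stored as several codewords (stripes) of $C$, one coordinate per server. In each round the user masks every stripe of every file by an independent uniformly random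 codeword of $D$, and adds fixed offset words at the stripes of the requested file; each server receives its coordinates of these words and returns the inner product with its stored symbols; the user recovers the requested file from the responses modulo $C\star D$. The scheme has privacy $t$ (resists a $t$-collusion attack) if the joint distribution of the queries received by any at most $t$ servers does not depend on which file is requested. Its rate is the size of a file divided by the total number of downloaded symbols. Schemes below are for an arbitrary number of files. Let $C$ be the binary code with defining set $\Delta_C=I_{(0,0)}$. Then $n_J=2^{r+1}$ and $C$ is the $[2^{r+1},1]$ repetition code. Moreover: (a) Let $D$ be the binary code with $\Delta_D=I_{(0,0)}\cup I_{(1,0)}\cup I_{(0,1)}$. Then $d(D^\perp)=4$, and there is a Schur product PIR scheme for $(C,D)$ of length $n_J$, privacy $3$ and rate $$\frac{n_J-(r+2)}{n_J}.$$ For the pair $\mathrm{RM}_2(0,r+1)$, $D'=\mathrm{RM}_2(1,r+1)$ one has $D'^\perp=\mathrm{RM}_2(r-1,r+1)$, $d(D'^\perp)=4$, and there is a Schur product PIR scheme with the same length, privacy and rate. (b) Let $r\ge 2$ and let $D$ be the binary code with $\Delta_D=I_{(0,0)}\cup I_{(0,1)}\cup I_{(1,1)}\cup I_{(1,0)}\cup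 I_{(3,0)}\cup I_{(5,0)}$. Then $\dim D\le 4r+2$ and $d(D^\perp)=8$, and there is a Schur product PIR scheme for $(C,D)$ with privacy $7$ and rate $$\frac{\dim (C\star D)^\perp}{n_J}\ \ge\ \frac{n_J-(4r+2)}{n_J}.$$ For the pair $\mathrm{RM}_2(0,r+1)$, $D'=\mathrm{RM}_2(2,r+1)$ one has $d(D'^\perp)=8$ and $\dim D'=b:=\binom{r+1}{0}+\binom{r+1}{1}+\binom{r+1}{2}$, and there is a Schur product PIR scheme with privacy $7$ and rate $(n_J-b)/n_J$. If $b>4r+2$, then the rate of the above scheme for $(C,D)$ is larger than the rate of every Schur product PIR scheme for $(\mathrm{RM}_2(0,r+1),\mathrm{RM}_2(2,r+1))$. The inequality $b>4r+2$ holds for all $r>5$. -/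

import Mathlib

universe u v

section Codes

/-- Evaluation at the points `P i` of the monomial `X ^ e`. -/
def evalMonomial {K ι : Type*} [Field K] {m : ℕ} (P : ι → Fin m → K) (e : Fin m → ℕ) : ι → K :=
  fun i => ∏ j, P i j ^ e j

/-- The monomial evaluation code with exponent set `Δ`, evaluated at the points `P i`. -/
def monomialCode {K ι : Type*} [Field K] {m : ℕ} (P : ι → Fin m → K) (Δ : Set (Fin m → ℕ)) :
    Submodule K (ι → K) :=
  Submodule.span K (evalMonomial P '' Δ)

/-- The Reed–Muller code of order `s` in `m` variables over the finite field `K`; its coordinates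
are indexed by `K ^ m`. -/
def reedMuller (K : Type*) [Field K] (s m : ℕ) : Submodule K ((Fin m → K) → K) :=
  monomialCode (fun P : Fin m → K => P) {e | (∀ j, e j < Nat.card K) ∧ ∑ j, e j ≤ s}

/-- The zero locus of the polynomials `X_j ^ (N_j - 1) - 1` (`j ∈ J`) and
`X_j ^ N_j - X_j` (`j ∉ J`). -/
def jAffinePoints (K : Type*) [Field K] {m : ℕ} (J : Finset (Fin m)) (N : Fin m → ℕ) :
    Set (Fin m → K) :=
  {P | ∀ j, if j ∈ J then P j ^ (N j - 1) = 1 else P j ^ N j = P j}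

noncomputable instance {K : Type*} [Field K] [Finite K] {m : ℕ} (J : Finset (Fin m))
    (N : Fin m → ℕ) : Fintype (jAffinePoints K J N) :=
  Fintype.ofFinite _

/-- The `J`-affine variety code with exponent set `Δ`. -/
def jAffineCode (K : Type*) [Field K] {m : ℕ} (J : Finset (Fin m)) (N : Fin m → ℕ)
    (Δ : Set (Fin m → ℕ)) : Submodule K (jAffinePoints K J N → K) :=
  monomialCode (fun P : jAffinePoints K J N => (P : Fin m → K)) Δ

/-- Reduction of exponents: modulo `N_j - 1` into `{0, …, N_j - 2}` if `j ∈ J`; if `j ∉ J`,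
`0` is kept and positive exponents are reduced modulo `N_j - 1` into `{1, …, N_j - 1}`. -/
def reduceExponent {m : ℕ} (J : Finset (Fin m)) (N : Fin m → ℕ) (a : Fin m → ℕ) : Fin m → ℕ :=
  fun j => if j ∈ J then a j % (N j - 1) else if a j = 0 then 0 else (a j - 1) % (N j - 1) + 1

/-- The minimal cyclotomic set `I_a` with respect to `q`, i.e. all `q ^ i • a`, reduced. -/
def cyclotomicSet {m : ℕ} (q : ℕ) (J : Finset (Fin m)) (N : Fin m → ℕ) (a : Fin m → ℕ) :
    Set (Fin m → ℕ) :=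
  Set.range fun i : ℕ => reduceExponent J N (fun j => q ^ i * a j)

/-- The subfield subcode over `k` of a code over `K`: the words with entries in `k` whose image
in `K ^ ι` lies in `C`. -/
def subfieldSubcode (k : Type*) {K ι : Type*} [Field k] [Field K] [Algebra k K]
    (C : Submodule K (ι → K)) : Submodule k (ι → k) :=
  (C.restrictScalars k).comap ((Algebra.linearMap k K).compLeft ι)

/-- The dual code with respect to the standard bilinear form. -/
def dualCode {F ι : Type*} [Field F] [Fintype ι] (C : Submodule F (ι → F)) :
    Submodule F (ι → F) where
  carrier := {x | ∀ c ∈ C, x ⬝ᵥ c = 0}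
  add_mem' hx hy c hc := by rw [add_dotProduct, hx c hc, hy c hc, add_zero]
  zero_mem' c _ := zero_dotProduct c
  smul_mem' a x hx c hc := by rw [smul_dotProduct, hx c hc, smul_zero]

/-- The componentwise (Schur, star) product of two codes. -/
def starProduct {F ι : Type*} [Field F] (C D : Submodule F (ι → F)) : Submodule F (ι → F) :=
  Submodule.span F {x | ∃ c ∈ C, ∃ d ∈ D, x = c * d}

/-- `C` is a nonzero code and its minimum Hamming distance is `d`. -/
def HasMinDist {F ι : Type*} [Field F] [DecidableEq F] [Fintype ι] (C : Submodule F (ι → F))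
    (d : ℕ) : Prop :=
  IsLeast {w | ∃ c ∈ C, c ≠ 0 ∧ hammingNorm c = w} d

end Codes

section PIR

/-- A private information retrieval scheme for `M` files on a storage system encoded by `C`, with
one server for each coordinate in `ι`. A file consists of `stripes` codewords of `C`, and server
`j` stores the `j`-th entry of each of these codewords of each file. To retrieve file `i` the user
draws a vector of queries from `queryLaw i` and sends its `j`-th entry to server `j`, which answers
with `download j` symbols, computed from the query and from what it stores. -/
structure PIRScheme {F : Type u} {ι : Type v} [Field F] (C : Submodule F (ι → F)) (M : ℕ) where
  stripes : ℕ
  download : ι → ℕ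
  Query : Type u
  queryLaw : Fin M → PMF (ι → Query)
  answer : (j : ι) → Query → (Fin M → Fin stripes → F) → Fin (download j) → F
  decode : Fin M → (ι → Query) → ((j : ι) → Fin (download j) → F) → Fin stripes → C
  correct : ∀ i, ∀ q ∈ (queryLaw i).support, ∀ X : Fin M → Fin stripes → C,
    decode i q (fun j => answer j (q j) (fun m l => (X m l : ι → F) j)) = X i

/-- The joint law of the queries received by any `t` (or fewer) servers does not depend on the
index of the requested file. -/
def PIRScheme.ResistsCollusion {F : Type u} {ι : Type v} [Field F] {C : Submodule F (ι → F)}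
    {M : ℕ} (P : PIRScheme C M) (t : ℕ) : Prop :=
  ∀ T : Finset ι, T.card ≤ t → ∀ i i' : Fin M,
    (P.queryLaw i).map (fun q (j : T) => q j) = (P.queryLaw i').map (fun q (j : T) => q j)

/-- The PIR rate: the size of a file divided by the total download, both in symbols of `F`. -/
noncomputable def PIRScheme.rate {F : Type u} {ι : Type v} [Field F] [Fintype ι]
    {C : Submodule F (ι → F)} {M : ℕ} (P : PIRScheme C M) : ℚ :=
  ((P.stripes * Module.finrank F C : ℕ) : ℚ) / ((∑ j, P.download j : ℕ) : ℚ)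

/-- The data of a Schur product scheme with storage code `C` and retrieval code `D`. In each of
`rounds` rounds, every stripe of every file is masked by a random codeword of `D`, to which the
word `offset s l` is added for stripe `l` of the requested file. The responses of a round form a
word which is, modulo the code `C ⋆ D`, the sum over `l` of the products of `offset s l` with the
stripes of the requested file, and the user decodes from these classes modulo `C ⋆ D`
(equivalently, from the products of the responses with the words of the dual of `C ⋆ D`). -/
structure SchurScheme {F : Type u} {ι : Type v} [Field F] (C D : Submodule F (ι → F)) where
  stripes : ℕ
  rounds : ℕ
  offset : Fin rounds → Fin stripes → ι → F
  decode : (Fin rounds → (ι → F) ⧸ starProduct C D) → Fin stripes → C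
  correct : ∀ X : Fin stripes → C,
    decode (fun s => Submodule.Quotient.mk
      (fun j => ∑ l, offset s l j * (X l : ι → F) j)) = X

/-- The query for file `i` with masks `d`: for each server `j`, round `s`, file `m`, stripe `l`,
the `j`-th entry of the mask, plus that of the offset if `m` is the requested file. -/
def SchurScheme.query {F : Type u} {ι : Type v} [Field F] {C D : Submodule F (ι → F)}
    (S : SchurScheme C D) {M : ℕ} (i : Fin M) (d : Fin S.rounds → Fin M → Fin S.stripes → D) :
    ι → Fin S.rounds → Fin M → Fin S.stripes → F :=
  fun j s m l => (d s m l : ι → F) j + if m = i then S.offset s l j else 0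

theorem SchurScheme.mk_response {F : Type u} {ι : Type v} [Field F] {C D : Submodule F (ι → F)}
    (S : SchurScheme C D) {M : ℕ} (i : Fin M) (d : Fin S.rounds → Fin M → Fin S.stripes → D)
    (X : Fin M → Fin S.stripes → C) (s : Fin S.rounds) :
    (Submodule.Quotient.mk (fun j => ∑ m, ∑ l, S.query i d j s m l * (X m l : ι → F) j) :
        (ι → F) ⧸ starProduct C D) =
      Submodule.Quotient.mk (fun j => ∑ l, S.offset s l j * (X i l : ι → F) j) := by
  rw [Submodule.Quotient.eq]
  have h : ((fun j => ∑ m, ∑ l, S.query i d j s m l * (X m l : ι → F) j) -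
      fun j => ∑ l, S.offset s l j * (X i l : ι → F) j) =
      ∑ m, ∑ l, (X m l : ι → F) * (d s m l : ι → F) := by
    funext j
    simp [SchurScheme.query, add_mul, Finset.sum_add_distrib, ite_mul, mul_comm]
  rw [h]
  exact Submodule.sum_mem _ fun m _ => Submodule.sum_mem _ fun l _ =>
    Submodule.subset_span ⟨_, (X m l).2, _, (d s m l).2, rfl⟩

/-- The scheme for `M` files: the masks are independent and uniform in `D`, and in each round a
server returns the inner product of its query with its stored symbols. -/
noncomputable def SchurScheme.toPIR {F : Type u} {ι : Type v} [Field F] [Finite F] [Finite ι]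
    {C D : Submodule F (ι → F)} (S : SchurScheme C D) (M : ℕ) : PIRScheme C M where
  stripes := S.stripes
  download := fun _ => S.rounds
  Query := Fin S.rounds → Fin M → Fin S.stripes → F
  queryLaw i :=
    haveI : Fintype (Fin S.rounds → Fin M → Fin S.stripes → D) := Fintype.ofFinite _
    (PMF.uniformOfFintype (Fin S.rounds → Fin M → Fin S.stripes → D)).map (S.query i)
  answer _ q y s := ∑ m, ∑ l, q s m l * y m l
  decode _ _ a := S.decode fun s => Submodule.Quotient.mk fun j => a j s
  correct := by
    intro i q hq X
    rw [PMF.support_map] at hq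
    obtain ⟨d, -, rfl⟩ := hq
    simp only [SchurScheme.mk_response]
    exact S.correct (X i)

end PIR

section Construction

/-- The binary code with defining set `Δ`: the subfield subcode over `𝔽₂` of the affine variety
code over `K`, in two variables, with `J = ∅`, `N₁ = 2 ^ r` and `N₂ = 2`. -/
def binCode (K : Type*) [Field K] [Algebra (ZMod 2) K] (r : ℕ) (Δ : Set (Fin 2 → ℕ)) :
    Submodule (ZMod 2) (jAffinePoints K ∅ ![2 ^ r, 2] → ZMod 2) :=
  subfieldSubcode (ZMod 2) (jAffineCode K ∅ ![2 ^ r, 2] Δ)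

/-- The binary cyclotomic set `I_(a,b)` for `J = ∅`, `N₁ = 2 ^ r` and `N₂ = 2`. -/
def binCoset (r a b : ℕ) : Set (Fin 2 → ℕ) :=
  cyclotomicSet 2 ∅ ![2 ^ r, 2] ![a, b]

end Construction

/-! ### Dual codes and projections onto few coordinates. -/

section DualCodes

variable {F ι : Type*} [Field F]

/-! Multiplying by the repetition code changes nothing, so `C ⋆ D = D`, and every assertion about
schemes reduces to `dim D` and the dual distance of `D`.

Privacy: if every nonzero word of the dual of `D` has weight above `t`, then `D` projects onto any
`t` coordinates. On the colluding servers the offsets then agree with words of `D`, and adding them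
to uniform masks does not change the law (`SchurScheme.resistsCollusion`).

Rate: decoding makes a linear map from the files to the responses modulo `C ⋆ D` injective, so the
rate is at most `1 - dim (C ⋆ D) / n` (`SchurScheme.rate_toPIR_le`). For the repetition code,
offsets independent modulo `D` attain this in one round (`exists_schurScheme_span_one`).

Dual distance: by Delsarte's theorem (`mem_dualCode_subfieldSubcode_iff`) a word is dual to a binary
code here when certain monomial sums vanish. Cutting `Z` into the lines `y = 0` and `y = 1` turns
these sums into power moments of the upper half and of the sum of both halves. The dual is thus a
`(u | u + v)` code built from BCH-type codes, and the BCH bound gives 4 and 8. For Reed–Muller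
codes, a point of a small support is isolated by a low-degree polynomial
(`exists_mem_reedMuller_isolating`). -/

theorem starProduct_span_one (D : Submodule F (ι → F)) :
    starProduct (Submodule.span F {fun _ => 1}) D = D := by
  apply le_antisymm
  · refine Submodule.span_le.2 ?_
    rintro _ ⟨c, hc, d, hd, rfl⟩
    obtain ⟨a, rfl⟩ := Submodule.mem_span_singleton.1 hc
    have : (a • fun _ => 1 : ι → F) * d = a • d := by ext; simp
    rw [this]
    exact D.smul_mem a hd
  · exact fun d hd => Submodule.subset_span
      ⟨_, Submodule.mem_span_singleton_self _, d, hd, by ext; simp⟩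

theorem finrank_span_one [Nonempty ι] :
    Module.finrank F (Submodule.span F {(fun _ => 1 : ι → F)}) = 1 :=
  finrank_span_singleton fun h => one_ne_zero (congrFun h (Classical.arbitrary ι))

variable [Fintype ι]

theorem mem_dualCode_iff {C : Submodule F (ι → F)} {x : ι → F} :
    x ∈ dualCode C ↔ ∀ c ∈ C, x ⬝ᵥ c = 0 := Iff.rfl

theorem finrank_add_finrank_dualCode (C : Submodule F (ι → F)) :
    Module.finrank F C + Module.finrank F (dualCode C) = Fintype.card ι := by
  classical
  have h : dualCode C = C.dualAnnihilator.comap (dotProductEquiv F ι).toLinearMap := by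
    ext x
    simp [mem_dualCode_iff, Submodule.mem_dualAnnihilator]
  have h' : Module.finrank F (dualCode C) = Module.finrank F C.dualAnnihilator := by
    rw [h]
    exact LinearEquiv.finrank_eq ((dotProductEquiv F ι).ofSubmodule' C.dualAnnihilator)
  rw [h', Subspace.finrank_add_finrank_dualAnnihilator_eq, Module.finrank_pi]

/-- A code is the whole dual of another one as soon as it lies in it and is large enough. -/
theorem dualCode_eq_of_le {C D : Submodule F (ι → F)} (h : D ≤ dualCode C)
    (hcard : Fintype.card ι ≤ Module.finrank F C + Module.finrank F D) : dualCode C = D := by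
  refine (Submodule.eq_of_le_of_finrank_le h ?_).symm
  have := finrank_add_finrank_dualCode C
  omega

/-- A code projects onto any set of coordinates smaller than the minimum weight of its dual. -/
theorem exists_mem_eq_on_of_lt_dual_weight [DecidableEq F] {D : Submodule F (ι → F)} {t : ℕ}
    (hD : ∀ x ∈ dualCode D, x ≠ 0 → t < hammingNorm x) {T : Finset ι} (hT : T.card ≤ t)
    (w : ι → F) : ∃ d ∈ D, ∀ j ∈ T, d j = w j := by
  classical
  let π : (ι → F) →ₗ[F] (T → F) := LinearMap.funLeft F F (fun j : T => (j : ι))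
  suffices h : D.map π = ⊤ by
    obtain ⟨d, hd, hdw⟩ := Submodule.mem_map.1 (h ▸ Submodule.mem_top : π w ∈ D.map π)
    exact ⟨d, hd, fun j hj => congrFun hdw ⟨j, hj⟩⟩
  -- A functional killing a proper image of `D` pulls back to a nonzero dual word supported in `T`,
  -- which is too light.
  by_contra h
  obtain ⟨f, hf, hfD⟩ := Submodule.exists_le_ker_of_lt_top _ (lt_top_iff_ne_top.2 h)
  obtain ⟨x, hx⟩ := (dotProductEquiv F ι).surjective (f ∘ₗ π)
  have hx' (y : ι → F) : x ⬝ᵥ y = f (π y) := by rw [← LinearMap.comp_apply, ← hx]; rfl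
  have hsupp (j : ι) (hj : j ∉ T) : x j = 0 := by
    have hz : π (Pi.single j 1) = 0 := by
      ext k
      exact Pi.single_eq_of_ne (fun e : (k : ι) = j => hj (e ▸ k.2)) _
    simpa [hz] using hx' (Pi.single j 1)
  have hx0 : x ≠ 0 := by
    rintro rfl
    refine hf (LinearMap.ext fun y => ?_)
    obtain ⟨z, rfl⟩ : ∃ z, π z = y :=
      ⟨fun j => if hj : j ∈ T then y ⟨j, hj⟩ else 0, by ext k; simp [π, LinearMap.funLeft]⟩
    rw [← hx', zero_dotProduct, LinearMap.zero_apply]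
  have hxD : x ∈ dualCode D := fun c hc => (hx' c).trans (hfD (Submodule.mem_map_of_mem hc))
  have hle : hammingNorm x ≤ T.card := by
    refine Finset.card_le_card fun j hj => ?_
    by_contra hjT
    exact (Finset.mem_filter.1 hj).2 (hsupp j hjT)
  exact absurd (hD x hxD hx0) (by omega)

end DualCodes

/-! ### Privacy and rate of Schur product schemes. -/

section Schemes

theorem PMF.map_map_uniformOfFintype_of_equiv {α β γ : Type*} [Fintype α] [Nonempty α]
    {f : α → β} {g : β → γ} {h : α → γ} (e : α ≃ α) (H : ∀ a, g (f a) = h (e a)) :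
    ((PMF.uniformOfFintype α).map f).map g = (PMF.uniformOfFintype α).map h := by
  classical
  rw [PMF.map_comp]
  ext c
  simp only [PMF.map_apply, Function.comp_apply, H, PMF.uniformOfFintype_apply]
  exact e.tsum_eq fun a => if c = h a then ((Fintype.card α : ENNReal))⁻¹ else 0

variable {F : Type u} {ι : Type v} [Field F] [Fintype ι] {C D : Submodule F (ι → F)}

/-- For every requested file, the queries seen by `T` have the law of the bare masks: replacing the
offsets by words of `D` equal to them on `T` makes the query a translate of the mask. -/
theorem SchurScheme.resistsCollusion [Finite F] [DecidableEq F] (S : SchurScheme C D) (M : ℕ)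
    {t : ℕ} (hD : ∀ x ∈ dualCode D, x ≠ 0 → t < hammingNorm x) :
    (S.toPIR M).ResistsCollusion t := by
  intro T hT
  let _ : Fintype (Fin S.rounds → Fin M → Fin S.stripes → D) := Fintype.ofFinite _
  suffices h : ∀ i : Fin M, ((S.toPIR M).queryLaw i).map (fun q (j : T) => q j) =
      (PMF.uniformOfFintype (Fin S.rounds → Fin M → Fin S.stripes → D)).map
        (fun d (j : T) s m l => (d s m l : ι → F) j) from
    fun i i' => (h i).trans (h i').symm
  intro i
  choose w hwD hw using fun s l => exists_mem_eq_on_of_lt_dual_weight hD hT (S.offset s l)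
  let d₀ : Fin S.rounds → Fin M → Fin S.stripes → D :=
    fun s m l => if m = i then ⟨w s l, hwD s l⟩ else 0
  refine PMF.map_map_uniformOfFintype_of_equiv (Equiv.addRight d₀) fun d => ?_
  funext j s m l
  change S.query i d j s m l = ((d + d₀) s m l : ι → F) j
  by_cases h : m = i <;> simp [SchurScheme.query, d₀, h, hw s l j j.2]

theorem SchurScheme.rate_toPIR [Finite F] (S : SchurScheme C D) (M : ℕ) :
    (S.toPIR M).rate = (S.stripes * Module.finrank F C : ℚ) / (Fintype.card ι * S.rounds) := by
  simp [PIRScheme.rate, SchurScheme.toPIR]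

/-- A Schur product scheme recovers at most `n - dim (C ⋆ D)` symbols in each round. -/
theorem SchurScheme.stripes_mul_finrank_le (S : SchurScheme C D) :
    S.stripes * Module.finrank F C + S.rounds * Module.finrank F (starProduct C D) ≤
      S.rounds * Fintype.card ι := by
  let f : (Fin S.stripes → C) →ₗ[F] (Fin S.rounds → (ι → F) ⧸ starProduct C D) :=
    LinearMap.pi fun s => (starProduct C D).mkQ ∘ₗ
      ∑ l, (LinearMap.mulLeft F (S.offset s l)) ∘ₗ C.subtype ∘ₗ LinearMap.proj l
  have hf (X : Fin S.stripes → C) : f X = fun s => Submodule.Quotient.mk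
      (fun j => ∑ l, S.offset s l j * (X l : ι → F) j) := by
    funext s
    simp only [f, LinearMap.pi_apply, LinearMap.comp_apply, Submodule.mkQ_apply]
    congr 1
    ext j
    simp [LinearMap.sum_apply, Finset.sum_apply]
  -- `S.decode` need not be linear; it serves only as a left inverse of the linear map `f`.
  have hinj : Function.Injective f :=
    Function.LeftInverse.injective (g := S.decode) fun X => by rw [hf, S.correct]
  have h := LinearMap.finrank_le_finrank_of_injective hinj
  rw [Module.finrank_pi_fintype, Module.finrank_pi_fintype] at h
  simp only [Finset.sum_const, Finset.card_univ, Fintype.card_fin, smul_eq_mul] at h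
  have hq := Submodule.finrank_quotient_add_finrank (starProduct C D)
  rw [Module.finrank_pi] at hq
  rw [← hq, mul_add]
  omega

theorem SchurScheme.rate_toPIR_le [Finite F] [Nonempty ι] (S : SchurScheme C D) (M : ℕ) :
    (S.toPIR M).rate ≤
      ((Fintype.card ι : ℚ) - Module.finrank F (starProduct C D)) / Fintype.card ι := by
  have hn : (0 : ℚ) < Fintype.card ι := by exact_mod_cast Fintype.card_pos
  have hle : (Module.finrank F (starProduct C D) : ℚ) ≤ Fintype.card ι := by
    have := finrank_add_finrank_dualCode (starProduct C D)
    exact_mod_cast (by omega)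
  rw [S.rate_toPIR M]
  -- With no rounds nothing is downloaded, and the rate is `0` by the convention for division by
  -- zero.
  rcases Nat.eq_zero_or_pos S.rounds with h0 | hpos
  · rw [h0, Nat.cast_zero, mul_zero, div_zero]
    exact div_nonneg (sub_nonneg.2 hle) hn.le
  · have hpos' : (0 : ℚ) < S.rounds := by exact_mod_cast hpos
    have h : (S.stripes * Module.finrank F C + S.rounds * Module.finrank F (starProduct C D) : ℚ)
        ≤ S.rounds * Fintype.card ι := by exact_mod_cast S.stripes_mul_finrank_le
    rw [div_le_div_iff₀ (mul_pos hn hpos') hn]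
    nlinarith

/-- For the repetition code, one round of the scheme whose offsets are independent modulo `D`
recovers one symbol for each offset. -/
theorem exists_schurScheme_span_one [Nonempty ι] {D : Submodule F (ι → F)} {k : ℕ}
    (hk : k + Module.finrank F D ≤ Fintype.card ι) :
    ∃ S : SchurScheme (Submodule.span F {fun _ => 1}) D, S.stripes = k ∧ S.rounds = 1 := by
  classical
  have hq := Submodule.finrank_quotient_add_finrank D
  rw [Module.finrank_pi] at hq
  obtain ⟨v, hv⟩ := exists_linearIndependent_of_le_finrank
    (show k ≤ Module.finrank F ((ι → F) ⧸ D) by omega)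
  choose w hw using fun l => D.mkQ_surjective (v l)
  let g : (Fin k → (Submodule.span F {(fun _ => 1 : ι → F)})) →
      (Fin 1 → (ι → F) ⧸ starProduct (Submodule.span F {fun _ => 1}) D) :=
    fun X _ => Submodule.Quotient.mk (fun j => ∑ l, w l j * (X l : ι → F) j)
  -- The stripes are constant words `a l`, so the response is `∑ a l • v l` modulo `D`, and
  -- independence of the `v l` recovers the scalars.
  have hg : Function.Injective g := by
    intro X Y hXY
    choose a ha using fun l => Submodule.mem_span_singleton.1 (X l).2
    choose b hb using fun l => Submodule.mem_span_singleton.1 (Y l).2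
    have h0 := congrFun hXY 0
    rw [Submodule.Quotient.eq, starProduct_span_one] at h0
    have h1 : ∑ l, (a l - b l) • w l ∈ D := by
      convert h0 using 1
      ext j
      simp only [← ha, ← hb, Finset.sum_apply, Pi.smul_apply, Pi.sub_apply, smul_eq_mul, mul_one]
      rw [← Finset.sum_sub_distrib]
      exact Finset.sum_congr rfl fun l _ => by ring
    have h2 : ∑ l, (a l - b l) • v l = 0 := by
      rw [← (Submodule.Quotient.mk_eq_zero D)] at h1
      rw [← h1, ← Submodule.mkQ_apply, map_sum]
      simp only [map_smul, hw]
    have h3 := Fintype.linearIndependent_iff.1 hv _ h2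
    funext l
    exact Subtype.ext (by rw [← ha, ← hb, sub_eq_zero.1 (h3 l)])
  exact ⟨⟨k, 1, fun _ l => w l, Function.invFun g, fun X => Function.leftInverse_invFun hg X⟩,
    rfl, rfl⟩

/-- Any `k` up to `n - dim D` is allowed, so an upper bound on `dim D` is enough to realise a
prescribed rate exactly. -/
theorem exists_schurScheme_span_one_rate [Finite F] [DecidableEq F] [Nonempty ι]
    {D : Submodule F (ι → F)} {k t : ℕ} (hk : k + Module.finrank F D ≤ Fintype.card ι)
    (hD : ∀ x ∈ dualCode D, x ≠ 0 → t < hammingNorm x) :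
    ∃ S : SchurScheme (Submodule.span F {fun _ => 1}) D, ∀ M : ℕ,
      (S.toPIR M).ResistsCollusion t ∧ (S.toPIR M).rate = (k : ℚ) / Fintype.card ι := by
  obtain ⟨S, hs, hr⟩ := exists_schurScheme_span_one hk
  refine ⟨S, fun M => ⟨S.resistsCollusion M hD, ?_⟩⟩
  rw [S.rate_toPIR, finrank_span_one, hs, hr]
  simp

end Schemes

/-! ### Binary Reed–Muller codes: dimension, duality, dual distance. -/

section ReedMuller

theorem nat_card_zmod_two : Nat.card (ZMod 2) = 2 := by simp

theorem reedMuller_zmod_two (s m : ℕ) : reedMuller (ZMod 2) s m =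
    monomialCode (fun P : Fin m → ZMod 2 => P) {e | (∀ j, e j < 2) ∧ ∑ j, e j ≤ s} := by
  rw [reedMuller, nat_card_zmod_two]

theorem evalMonomial_mem_reedMuller {s m : ℕ} {e : Fin m → ℕ} (he : ∀ j, e j < 2)
    (hs : ∑ j, e j ≤ s) :
    evalMonomial (fun P : Fin m → ZMod 2 => P) e ∈ reedMuller (ZMod 2) s m := by
  rw [reedMuller_zmod_two]
  exact Submodule.subset_span ⟨e, ⟨he, hs⟩, rfl⟩

theorem one_mem_reedMuller (s m : ℕ) : (fun _ => 1) ∈ reedMuller (ZMod 2) s m := by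
  convert evalMonomial_mem_reedMuller (s := s) (e := fun _ : Fin m => 0) (by simp) (by simp) using 1
  ext P
  simp [evalMonomial]

theorem reedMuller_zero (m : ℕ) :
    reedMuller (ZMod 2) 0 m = Submodule.span (ZMod 2) {fun _ => 1} := by
  apply le_antisymm
  · rw [reedMuller_zmod_two]
    refine Submodule.span_le.2 ?_
    rintro _ ⟨e, ⟨-, he⟩, rfl⟩
    have h0 : ∀ j, e j = 0 := by simpa using he
    refine Submodule.subset_span ?_
    ext P
    simp [evalMonomial, h0]
  · exact Submodule.span_le.2 (by simpa using one_mem_reedMuller 0 m)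

theorem zmod_two_pow_of_pos (x : ZMod 2) {k : ℕ} (hk : 0 < k) : x ^ k = x := by
  fin_cases x
  · exact zero_pow hk.ne'
  · exact one_pow k

theorem evalMonomial_min_one {m : ℕ} (e : Fin m → ℕ) :
    evalMonomial (fun P : Fin m → ZMod 2 => P) (fun j => min (e j) 1) =
      evalMonomial (fun P : Fin m → ZMod 2 => P) e := by
  ext P
  refine Finset.prod_congr rfl fun j _ => ?_
  rcases Nat.eq_zero_or_pos (e j) with h | h
  · simp [h]
  · have h1 : min (e j) 1 = 1 := Nat.min_eq_right h
    simp only [h1, pow_one, zmod_two_pow_of_pos _ h]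

theorem evalMonomial_mul {K ι : Type*} [Field K] {m : ℕ} (P : ι → Fin m → K) (e f : Fin m → ℕ) :
    evalMonomial P e * evalMonomial P f = evalMonomial P (e + f) := by
  ext i
  simp [evalMonomial, pow_add, Finset.prod_mul_distrib]

/-- Degrees add, and truncating exponents to 1, harmless over `𝔽₂`, can only lower them. -/
theorem reedMuller_mul_mem {s t m : ℕ} {c d : (Fin m → ZMod 2) → ZMod 2}
    (hc : c ∈ reedMuller (ZMod 2) s m) (hd : d ∈ reedMuller (ZMod 2) t m) :
    c * d ∈ reedMuller (ZMod 2) (s + t) m := by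
  rw [reedMuller_zmod_two, monomialCode] at hc hd
  induction hc, hd using Submodule.span_induction₂ with
  | mem_mem c d hc hd =>
    obtain ⟨e, he, rfl⟩ := hc
    obtain ⟨f, hf, rfl⟩ := hd
    rw [evalMonomial_mul, ← evalMonomial_min_one]
    refine evalMonomial_mem_reedMuller (fun j => by simp) ?_
    refine (Finset.sum_le_sum fun j _ => min_le_left _ _).trans ?_
    simpa [Finset.sum_add_distrib] using add_le_add he.2 hf.2
  | zero_left d _ => simp
  | zero_right c _ => simp
  | add_left a b d _ _ _ ha hb => rw [add_mul]; exact add_mem ha hb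
  | add_right a b d _ _ _ ha hb => rw [mul_add]; exact add_mem ha hb
  | smul_left r a b _ _ h => rw [smul_mul_assoc]; exact Submodule.smul_mem _ _ h
  | smul_right r a b _ _ h => rw [mul_smul_comm]; exact Submodule.smul_mem _ _ h

theorem coord_add_const_mem_reedMuller {m : ℕ} (j : Fin m) (a : ZMod 2) :
    (fun P => P j + a) ∈ reedMuller (ZMod 2) 1 m := by
  have h : (fun P : Fin m → ZMod 2 => P j) ∈ reedMuller (ZMod 2) 1 m := by
    convert evalMonomial_mem_reedMuller (s := 1) (e := Pi.single j 1)
      (fun k => by rcases eq_or_ne k j with rfl | h <;> simp [*]) (by simp) using 1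
    ext P
    rw [evalMonomial, Finset.prod_eq_single j] <;> simp +contextual
  exact add_mem h (by simpa [Pi.smul_def] using! Submodule.smul_mem _ a (one_mem_reedMuller 1 m))

/-- The squarefree monomials span the functions on `𝔽₂ ^ m`. -/
theorem span_range_evalMonomial_finset (m : ℕ) :
    Submodule.span (ZMod 2) (Set.range fun A : Finset (Fin m) =>
      evalMonomial (fun P : Fin m → ZMod 2 => P) fun j => if j ∈ A then 1 else 0) = ⊤ := by
  have h : reedMuller (ZMod 2) m m = ⊤ := by
    rw [eq_top_iff, ← MvPolynomial.map_restrict_dom_evalₗ (ZMod 2) (Fin m)]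
    rintro _ ⟨p, hp, rfl⟩
    have hp' : MvPolynomial.evalₗ (ZMod 2) (Fin m) p = ∑ e ∈ p.support,
        p.coeff e • evalMonomial (fun P : Fin m → ZMod 2 => P) e := by
      ext P
      rw [MvPolynomial.evalₗ_apply, MvPolynomial.eval_eq']
      simp [evalMonomial]
    rw [hp']
    refine Submodule.sum_mem _ fun e _ => Submodule.smul_mem _ _ ?_
    rw [← evalMonomial_min_one]
    refine evalMonomial_mem_reedMuller (fun j => by simp) ?_
    exact (Finset.sum_le_sum fun j _ => min_le_right _ _).trans (by simp)
  rw [eq_top_iff, ← h, reedMuller_zmod_two]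
  refine Submodule.span_le.2 ?_
  rintro _ ⟨e, ⟨he, -⟩, rfl⟩
  refine Submodule.subset_span ⟨Finset.univ.filter fun j => e j = 1, ?_⟩
  refine congrArg _ (funext fun j => ?_)
  have := he j
  by_cases h1 : e j = 1 <;> simp [h1]
  omega

theorem linearIndependent_evalMonomial_finset (m : ℕ) :
    LinearIndependent (ZMod 2) fun A : Finset (Fin m) =>
      evalMonomial (fun P : Fin m → ZMod 2 => P) fun j => if j ∈ A then 1 else 0 :=
  linearIndependent_of_top_le_span_of_card_eq_finrank
    (span_range_evalMonomial_finset m).ge (by simp)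

theorem finrank_reedMuller (s m : ℕ) :
    Module.finrank (ZMod 2) (reedMuller (ZMod 2) s m) = ∑ i ∈ Finset.range (s + 1), m.choose i := by
  classical
  let T : Finset (Finset (Fin m)) := Finset.univ.filter fun A => A.card ≤ s
  have h : reedMuller (ZMod 2) s m = Submodule.span (ZMod 2) (Set.range fun A : T =>
      evalMonomial (fun P : Fin m → ZMod 2 => P) fun j => if j ∈ (A : Finset (Fin m)) then 1 else 0) := by
    rw [reedMuller_zmod_two, monomialCode]
    congr 1
    ext c
    constructor
    · rintro ⟨e, ⟨he, hs⟩, rfl⟩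
      have h01 (j : Fin m) : (if e j = 1 then 1 else 0) = e j := by
        have := he j
        split_ifs <;> omega
      refine ⟨⟨Finset.univ.filter fun j => e j = 1, ?_⟩, by simp [h01]⟩
      simpa [T, Finset.card_filter, h01] using hs
    · rintro ⟨⟨A, hA⟩, rfl⟩
      refine ⟨_, ⟨fun j => ?_, ?_⟩, rfl⟩
      · dsimp only
        split_ifs <;> omega
      · simpa [T] using hA
  have hli := (linearIndependent_evalMonomial_finset m).comp (fun A : T => (A : Finset (Fin m)))
    Subtype.val_injective
  rw [h]
  refine (finrank_span_eq_card hli).trans ?_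
  rw [Fintype.card_coe]
  have hT : T = (Finset.range (s + 1)).biUnion fun i => Finset.univ.powersetCard i := by
    ext A
    simp [T]
  rw [hT, Finset.card_biUnion]
  · simp
  · exact fun i _ j _ hij => Finset.pairwise_disjoint_powersetCard _ hij

/-- A monomial of degree below `m` misses some variable. Its sum over the cube is a product over the
coordinates, in which that variable contributes `1 + 1 = 0`. -/
theorem sum_reedMuller_eq_zero {s m : ℕ} (hs : s < m) {c : (Fin m → ZMod 2) → ZMod 2}
    (hc : c ∈ reedMuller (ZMod 2) s m) : ∑ P, c P = 0 := by
  rw [reedMuller_zmod_two] at hc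
  induction hc using Submodule.span_induction with
  | mem c hc =>
    obtain ⟨e, ⟨-, he⟩, rfl⟩ := hc
    obtain ⟨j, hj⟩ : ∃ j, e j = 0 := by
      by_contra! h
      have := Finset.card_nsmul_le_sum Finset.univ e 1 fun j _ => Nat.one_le_iff_ne_zero.2 (h j)
      rw [Finset.card_univ, Fintype.card_fin, smul_eq_mul, mul_one] at this
      exact absurd (this.trans he) (by omega)
    simp only [evalMonomial]
    rw [← Fintype.piFinset_univ,
      ← Finset.prod_univ_sum (fun _ => Finset.univ) fun j (x : ZMod 2) => x ^ e j]
    refine Finset.prod_eq_zero (Finset.mem_univ j) ?_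
    rw [hj]
    simp only [pow_zero]
    decide
  | zero => simp
  | add a b _ _ ha hb => simp [Finset.sum_add_distrib, ha, hb]
  | smul a b _ hb => simp [← Finset.mul_sum, hb]

theorem dualCode_reedMuller {s t m : ℕ} (h : s + t + 1 = m) :
    dualCode (reedMuller (ZMod 2) s m) = reedMuller (ZMod 2) t m := by
  apply dualCode_eq_of_le
  · exact fun c hc d hd => sum_reedMuller_eq_zero (s := t + s) (by omega) (reedMuller_mul_mem hc hd)
  · rw [finrank_reedMuller, finrank_reedMuller]
    have h1 : ∑ i ∈ Finset.range (t + 1), m.choose i = ∑ i ∈ Finset.Ico (s + 1) (m + 1), m.choose i := by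
      rw [Finset.sum_Ico_eq_sum_range, show m + 1 - (s + 1) = t + 1 by omega]
      refine (Finset.sum_range_reflect _ _).symm.trans (Finset.sum_congr rfl fun i hi => ?_)
      rw [Finset.mem_range] at hi
      have hm : m = s + 1 + i + (t + 1 - 1 - i) := by omega
      exact (Nat.choose_symm_of_eq_add hm).symm
    rw [h1, Finset.sum_range_add_sum_Ico _ (show s + 1 ≤ m + 1 by omega), Nat.sum_range_choose]
    simp

/-- A nonempty set of fewer than `2 ^ (s + 1)` points contains a point which is isolated from the
others by a word of the Reed–Muller code of order `s`. -/
theorem exists_mem_reedMuller_isolating {m : ℕ} (s : ℕ) (S : Finset (Fin m → ZMod 2))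
    (hS : S.Nonempty) (hcard : S.card < 2 ^ (s + 1)) :
    ∃ g ∈ reedMuller (ZMod 2) s m, ∃ P ∈ S, ∀ Q ∈ S, g Q = if Q = P then 1 else 0 := by
  induction s generalizing S with
  | zero =>
    have hpos := hS.card_pos
    have h1 : S.card = 1 := by omega
    obtain ⟨P, rfl⟩ := Finset.card_eq_one.1 h1
    exact ⟨_, one_mem_reedMuller 0 m, P, by simp, by simp⟩
  | succ s ih =>
    by_cases hall : ∀ P ∈ S, ∀ Q ∈ S, P = Q
    · obtain ⟨P, hP⟩ := hS
      exact ⟨_, one_mem_reedMuller _ m, P, hP, fun Q hQ => by simp [hall Q hQ P hP]⟩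
    push Not at hall
    obtain ⟨P, hP, Q, hQ, hPQ⟩ := hall
    obtain ⟨j, hj⟩ := Function.ne_iff.1 hPQ
    have hsplit := Finset.card_filter_add_card_filter_not (s := S) fun R => R j = P j
    -- Coordinate `j` separates `P` from `Q`, so both halves are nonempty, and the smaller one has
    -- fewer than `2 ^ (s + 1)` points.
    have h2 : ∃ a : ZMod 2, (S.filter fun R => R j = a).Nonempty ∧
        (S.filter fun R => R j = a).card < 2 ^ (s + 1) := by
      have hPn : (S.filter fun R => R j = P j).Nonempty := ⟨P, by simp [hP]⟩
      have hQn : (S.filter fun R => R j = Q j).Nonempty := ⟨Q, by simp [hQ]⟩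
      have hneg : (S.filter fun R => ¬ R j = P j) = S.filter fun R => R j = Q j := by
        refine Finset.filter_congr fun R _ => ?_
        generalize R j = x, P j = y, Q j = z at hj
        clear * - hj
        revert x y z
        decide
      rw [hneg] at hsplit
      rw [pow_succ] at hcard
      by_cases hlt : (S.filter fun R => R j = P j).card < 2 ^ (s + 1)
      · exact ⟨_, hPn, hlt⟩
      · exact ⟨_, hQn, by omega⟩
    obtain ⟨a, hne, hlt⟩ := h2
    obtain ⟨g, hg, P, hP, hgP⟩ := ih _ hne hlt
    rw [Finset.mem_filter] at hP
    -- The factor `x_j + a + 1` is 1 on the chosen half and 0 on the other, at the cost of one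
    -- degree.
    refine ⟨_, reedMuller_mul_mem hg (coord_add_const_mem_reedMuller j (a + 1)), P, hP.1,
      fun Q hQ => ?_⟩
    rw [Pi.mul_apply]
    by_cases hQa : Q j = a
    · rw [hgP Q (Finset.mem_filter.2 ⟨hQ, hQa⟩), hQa, ← add_assoc, CharTwo.add_self_eq_zero,
        zero_add, mul_one]
    · have hz : Q j + (a + 1) = 0 := by
        generalize Q j = x at hQa
        clear * - hQa
        revert x a
        decide
      rw [hz, mul_zero, if_neg]
      rintro rfl
      exact hQa hP.2

/-- On a support that is too small, a word isolating a point `P` has product `c P ≠ 0` with `c`,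
against duality. -/
theorem le_hammingNorm_of_mem_dualCode_reedMuller {s m : ℕ} {c : (Fin m → ZMod 2) → ZMod 2}
    (hc : c ∈ dualCode (reedMuller (ZMod 2) s m)) (h0 : c ≠ 0) :
    2 ^ (s + 1) ≤ hammingNorm c := by
  by_contra! hlt
  obtain ⟨g, hg, P, hP, hgP⟩ := exists_mem_reedMuller_isolating s
    (Finset.univ.filter fun P => c P ≠ 0)
    (by obtain ⟨P, hP⟩ := Function.ne_iff.1 h0; exact ⟨P, by simpa using hP⟩) hlt
  have h := hc g hg
  rw [dotProduct, Finset.sum_eq_single P] at h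
  · rw [hgP P hP, if_pos rfl, mul_one] at h
    exact (Finset.mem_filter.1 hP).2 h
  · intro Q _ hQP
    by_cases hQ : c Q = 0
    · rw [hQ, zero_mul]
    · rw [hgP Q (by simpa using hQ), if_neg hQP, mul_zero]
  · simp

theorem hasMinDist_dualCode_reedMuller {s m : ℕ} (h : s < m) :
    HasMinDist (dualCode (reedMuller (ZMod 2) s m)) (2 ^ (s + 1)) := by
  refine ⟨?_, fun w ⟨c, hc, h0, hw⟩ => hw ▸ le_hammingNorm_of_mem_dualCode_reedMuller hc h0⟩
  -- The product of the last `m - s - 1` variables is the indicator of a subcube with `s + 1` free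
  -- coordinates.
  let e : Fin m → ℕ := fun j => if (j : ℕ) < s + 1 then 0 else 1
  have hlt : (Finset.univ.filter fun j : Fin m => (j : ℕ) < s + 1).card = s + 1 := by
    rw [Fin.card_filter_val_lt]
    omega
  have hge : (Finset.univ.filter fun j : Fin m => ¬ (j : ℕ) < s + 1).card = m - s - 1 := by
    have := Finset.card_filter_add_card_filter_not (s := (Finset.univ : Finset (Fin m)))
      fun j => (j : ℕ) < s + 1
    rw [hlt, Finset.card_univ, Fintype.card_fin] at this
    omega
  have hnorm : hammingNorm (evalMonomial (fun P : Fin m → ZMod 2 => P) e) = 2 ^ (s + 1) := by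
    have hsupp : (Finset.univ.filter fun P : Fin m → ZMod 2 =>
        evalMonomial (fun P : Fin m → ZMod 2 => P) e P ≠ 0) =
        Fintype.piFinset fun j : Fin m => if (j : ℕ) < s + 1 then Finset.univ else {1} := by
      ext P
      simp only [evalMonomial, e, Finset.mem_filter, Finset.mem_univ, true_and,
        Finset.prod_ne_zero_iff, Fintype.mem_piFinset, forall_const]
      refine forall_congr' fun j => ?_
      split_ifs
      · simp
      · generalize P j = x
        revert x
        decide
    rw [hammingNorm, hsupp, Fintype.card_piFinset]
    simp only [apply_ite Finset.card, Finset.card_univ, ZMod.card, Finset.card_singleton]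
    rw [Finset.prod_ite, Finset.prod_const, hlt, Finset.prod_const_one, mul_one]
  refine ⟨_, ?_, ?_, hnorm⟩
  · rw [dualCode_reedMuller (t := m - s - 1) (by omega)]
    refine evalMonomial_mem_reedMuller (fun j => ?_) ?_
    · dsimp only [e]
      split_ifs <;> omega
    · rw [Finset.sum_ite, Finset.sum_const_zero, zero_add, Finset.sum_const, hge, smul_eq_mul,
        mul_one]
  · intro h0
    rw [h0, hammingNorm_zero] at hnorm
    exact absurd hnorm.symm (by positivity)

end ReedMuller

/-! ### Delsarte duality for subfield subcodes. -/

section AffineVariety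

variable {K : Type*} [Field K] {m : ℕ} {J : Finset (Fin m)} {N : Fin m → ℕ}

theorem pow_mod_of_pow_eq_one {x : K} {n : ℕ} (h : x ^ n = 1) (a : ℕ) : x ^ (a % n) = x ^ a := by
  conv_rhs => rw [← Nat.mod_add_div a n, pow_add, pow_mul, h, one_pow, mul_one]

theorem pow_mod_of_pow_eq_self {x : K} {n : ℕ} (h : x ^ n = x) {a : ℕ} (ha : a ≠ 0) :
    x ^ ((a - 1) % (n - 1) + 1) = x ^ a := by
  by_cases hx : x = 0
  · rw [hx, zero_pow (Nat.succ_ne_zero _), zero_pow ha]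
  · have h1 : x ^ (n - 1) = 1 := by
      rcases n with - | n
      · simp
      · rw [Nat.add_sub_cancel]
        rw [pow_succ] at h
        exact mul_right_cancel₀ hx (h.trans (one_mul x).symm)
    rw [pow_succ, pow_mod_of_pow_eq_one h1, ← pow_succ, Nat.sub_add_cancel (by omega)]

theorem evalMonomial_reduceExponent (e : Fin m → ℕ) :
    evalMonomial (fun P : jAffinePoints K J N => (P : Fin m → K)) (reduceExponent J N e) =
      evalMonomial (fun P : jAffinePoints K J N => (P : Fin m → K)) e := by
  ext P
  refine Finset.prod_congr rfl fun j _ => ?_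
  have hP := P.2 j
  simp only [reduceExponent]
  split_ifs at hP ⊢ with hJ h0
  · exact pow_mod_of_pow_eq_one hP _
  · rw [h0]
  · exact pow_mod_of_pow_eq_self hP h0

theorem evalMonomial_nsmul {ι : Type*} (P : ι → Fin m → K) (q : ℕ) (e : Fin m → ℕ) (i : ι) :
    evalMonomial P (fun j => q * e j) i = evalMonomial P e i ^ q := by
  simp [evalMonomial, pow_mul', Finset.prod_pow]

variable {k : Type*} [Field k] [Algebra k K]

/-- The sum of a word over `k` against a function with values in `K` commutes with the powers of
the Frobenius map. -/
theorem sum_algebraMap_mul_pow [Finite k] {ι : Type*} [Fintype ι] (c : ι → k) (f : ι → K) (i : ℕ) :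
    ∑ P, algebraMap k K (c P) * f P ^ Nat.card k ^ i =
      (∑ P, algebraMap k K (c P) * f P) ^ Nat.card k ^ i := by
  have := Fintype.ofFinite k
  induction i with
  | zero => simp
  | succ i ih =>
    have h (x : K) : x ^ Nat.card k = FiniteField.frobeniusAlgHom k K x := by simp
    rw [pow_succ, pow_mul, ← ih, h, map_sum]
    refine Finset.sum_congr rfl fun P _ => ?_
    rw [map_mul, AlgHom.commutes, ← h, ← pow_mul]

variable [Finite K]

/-- **Delsarte's theorem** for affine variety codes: a word is dual to the subfield subcode defined
by a union of cyclotomic sets when it is orthogonal to the monomials of their representatives. -/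
theorem mem_dualCode_subfieldSubcode_iff [Finite k] (A : Set (Fin m → ℕ))
    (c : jAffinePoints K J N → k) :
    c ∈ dualCode (subfieldSubcode k (jAffineCode K J N
        (⋃ a ∈ A, cyclotomicSet (Nat.card k) J N a))) ↔
      ∀ a ∈ A, ∑ P, algebraMap k K (c P) *
        evalMonomial (fun P : jAffinePoints K J N => (P : Fin m → K)) a P = 0 := by
  set ev := evalMonomial (fun P : jAffinePoints K J N => (P : Fin m → K)) with hev
  have hfrob (a : Fin m → ℕ) (i : ℕ) (P : jAffinePoints K J N) :
      ev (reduceExponent J N fun j => Nat.card k ^ i * a j) P = ev a P ^ Nat.card k ^ i := by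
    rw [hev, evalMonomial_reduceExponent, evalMonomial_nsmul]
  constructor
  · intro hc a ha
    by_contra hne
    -- A nonzero sum is detected by a trace. The word `Tr (β * ev a)` has entries in `k` and is a
    -- combination of conjugates of `ev a`, so it lies in the subcode and `c` must be orthogonal to
    -- it.
    obtain ⟨β, hβ⟩ : ∃ β : K, Algebra.trace k K
        (β * ∑ P, algebraMap k K (c P) * ev a P) ≠ 0 := by
      have : Fintype k := Fintype.ofFinite k
      obtain ⟨y, hy⟩ := Algebra.trace_surjective k K 1
      exact ⟨y * (∑ P, algebraMap k K (c P) * ev a P)⁻¹, by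
        rw [inv_mul_cancel_right₀ hne, hy]; exact one_ne_zero⟩
    apply hβ
    have hmem : (fun P => Algebra.trace k K (β * ev a P)) ∈ subfieldSubcode k
        (jAffineCode K J N (⋃ a ∈ A, cyclotomicSet (Nat.card k) J N a)) := by
      have h : ((Algebra.linearMap k K).compLeft _ fun P => Algebra.trace k K (β * ev a P)) =
          ∑ i ∈ Finset.range (Module.finrank k K), (β ^ Nat.card k ^ i) •
            ev (reduceExponent J N fun j => Nat.card k ^ i * a j) := by
        ext P
        simp only [LinearMap.compLeft_apply, Function.comp_apply, Algebra.linearMap_apply,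
          FiniteField.algebraMap_trace_eq_sum_pow, Finset.sum_apply, Pi.smul_apply, hfrob,
          smul_eq_mul, mul_pow]
      rw [subfieldSubcode, Submodule.mem_comap, h]
      refine Submodule.sum_mem _ fun i _ => ?_
      refine Submodule.smul_mem (jAffineCode K J N _) _ (Submodule.subset_span ⟨_, ?_, rfl⟩)
      exact Set.mem_biUnion ha ⟨i, rfl⟩
    rw [← hc _ hmem, dotProduct, Finset.mul_sum, map_sum]
    refine Finset.sum_congr rfl fun P _ => ?_
    rw [mul_left_comm, ← Algebra.smul_def, map_smul, smul_eq_mul]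
  · intro hc d hd
    -- Frobenius carries the vanishing at `a` to its whole cyclotomic set, hence `c` is orthogonal
    -- to the full code over `K`.
    have hall (x : jAffinePoints K J N → K) (hx : x ∈ jAffineCode K J N
        (⋃ a ∈ A, cyclotomicSet (Nat.card k) J N a)) :
        ∑ P, algebraMap k K (c P) * x P = 0 := by
      induction hx using Submodule.span_induction with
      | mem x hx =>
        obtain ⟨e, he, rfl⟩ := hx
        obtain ⟨a, ha, i, rfl⟩ := Set.mem_iUnion₂.1 he
        have := sum_algebraMap_mul_pow c (ev a) i
        rw [hc a ha, zero_pow (pow_ne_zero _ Nat.card_pos.ne')] at this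
        simpa only [← hfrob] using this
      | zero => simp
      | add x y _ _ hx hy => simp [mul_add, Finset.sum_add_distrib, hx, hy]
      | smul a x _ hx => simp only [Pi.smul_apply, smul_eq_mul, mul_left_comm _ a, ← Finset.mul_sum,
          hx, mul_zero]
    apply (algebraMap k K).injective
    simpa [dotProduct] using hall _ hd

end AffineVariety

/-! ### Power moments and the BCH bound. -/

section Moments

variable {k K : Type*} [Field k] [Field K] [Fintype K] [Algebra k K]

/-- The power moments of a word whose coordinates are the elements of `K`. -/
def moment (k K : Type*) [Field k] [Field K] [Fintype K] [Algebra k K] (i : ℕ) :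
    (K → k) →ₗ[k] K :=
  Fintype.linearCombination k fun x : K => x ^ i

theorem moment_apply (i : ℕ) (f : K → k) :
    moment k K i f = ∑ x, algebraMap k K (f x) * x ^ i := by
  simp [moment, Fintype.linearCombination_apply, Algebra.smul_def]

theorem moment_zero_eq_zero_iff (f : K → k) : moment k K 0 f = 0 ↔ ∑ x, f x = 0 := by
  simp only [moment_apply, pow_zero, mul_one, ← map_sum, map_eq_zero]

theorem moment_card_mul_eq_zero [Finite k] {i : ℕ} {f : K → k} (h : moment k K i f = 0) :
    moment k K (Nat.card k * i) f = 0 := by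
  rw [moment_apply] at h ⊢
  have := sum_algebraMap_mul_pow f (fun x : K => x ^ i) 1
  rw [h, pow_one, zero_pow Nat.card_pos.ne'] at this
  simpa only [← pow_mul, mul_comm i] using this

/-- The BCH bound. -/
theorem lt_hammingNorm_of_moment_eq_zero [DecidableEq k] {f : K → k} (hf : f ≠ 0) {d : ℕ}
    (h : ∀ i < d, moment k K i f = 0) : d < hammingNorm f := by
  classical
  by_contra! hle
  obtain ⟨x₀, hx₀⟩ := Function.ne_iff.1 hf
  let S : Finset K := Finset.univ.filter fun x => f x ≠ 0
  have hx₀S : x₀ ∈ S := by simpa [S] using hx₀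
  -- `p` vanishes on the support except at `x₀` and has degree below `d`. Pairing it with `f` gives
  -- a combination of vanishing moments, yet only the nonzero term at `x₀` survives.
  let p : Polynomial K := ∏ x ∈ S.erase x₀, (Polynomial.X - Polynomial.C x)
  have hp : p.natDegree + 1 = S.card := by
    rw [Polynomial.natDegree_finsetProd_X_sub_C_eq_card]
    exact Finset.card_erase_add_one hx₀S
  have hsum : ∑ x, algebraMap k K (f x) * p.eval x = 0 := by
    simp only [Polynomial.eval_eq_sum_range, Finset.mul_sum]
    rw [Finset.sum_comm]
    refine Finset.sum_eq_zero fun i hi => ?_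
    have hi' : i < d := by
      rw [Finset.mem_range, hp] at hi
      exact hi.trans_le hle
    have := h i hi'
    rw [moment_apply] at this
    simp only [mul_left_comm _ (p.coeff i), ← Finset.mul_sum, this, mul_zero]
  rw [Finset.sum_eq_single x₀] at hsum
  · rcases mul_eq_zero.1 hsum with h0 | h0
    · exact hx₀ (by simpa using h0)
    · rw [Polynomial.eval_prod, Finset.prod_eq_zero_iff] at h0
      obtain ⟨x, hx, hx0⟩ := h0
      simp only [Polynomial.eval_sub, Polynomial.eval_X, Polynomial.eval_C, sub_eq_zero] at hx0
      exact Finset.ne_of_mem_erase hx hx0.symm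
  · intro x _ hx
    by_cases hfx : f x = 0
    · rw [hfx, map_zero, zero_mul]
    · rw [Polynomial.eval_prod, Finset.prod_eq_zero (i := x), mul_zero]
      · exact Finset.mem_erase.2 ⟨hx, by simpa [S] using hfx⟩
      · simp
  · simp

end Moments

/-! ### The two binary codes as `(u | u + v)` constructions. -/

section BinaryCodes

variable {K : Type*} [Field K] [Fintype K] {r : ℕ}

/-- The points of the affine variety are those of two copies of `K`, the lines `y = 0` and
`y = 1`. -/
noncomputable def sumEquivPoints (hK : Nat.card K = 2 ^ r) :
    K ⊕ K ≃ jAffinePoints K ∅ ![2 ^ r, 2] :=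
  have hpow (x : K) : x ^ 2 ^ r = x := by
    rw [← hK, Nat.card_eq_fintype_card, FiniteField.pow_card]
  Equiv.ofBijective
    (Sum.elim (fun x => ⟨![x, 0], fun j => by fin_cases j <;> simp [hpow]⟩)
      (fun x => ⟨![x, 1], fun j => by fin_cases j <;> simp [hpow]⟩))
    (by
      constructor
      · rintro (x | x) (y | y) h
        · exact congrArg Sum.inl (congrFun (congrArg Subtype.val h) 0 : x = y)
        · exact (zero_ne_one (congrFun (congrArg Subtype.val h) 1 : (0 : K) = 1)).elim
        · exact (one_ne_zero (congrFun (congrArg Subtype.val h) 1 : (1 : K) = 0)).elim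
        · exact congrArg Sum.inr (congrFun (congrArg Subtype.val h) 0 : x = y)
      · rintro ⟨P, hP⟩
        have h1 : P 1 * (P 1 - 1) = 0 := by
          have := hP 1
          simp at this
          linear_combination this
        rcases mul_eq_zero.1 h1 with h | h
        · exact ⟨Sum.inl (P 0), Subtype.ext (by ext j; fin_cases j <;> simp [h])⟩
        · exact ⟨Sum.inr (P 0), Subtype.ext (by ext j; fin_cases j <;> simp [sub_eq_zero.1 h])⟩)

theorem sumEquivPoints_inl (hK : Nat.card K = 2 ^ r) (x : K) :
    (sumEquivPoints hK (Sum.inl x) : Fin 2 → K) = ![x, 0] := rfl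

theorem sumEquivPoints_inr (hK : Nat.card K = 2 ^ r) (x : K) :
    (sumEquivPoints hK (Sum.inr x) : Fin 2 → K) = ![x, 1] := rfl

theorem card_points (hK : Nat.card K = 2 ^ r) :
    Nat.card (jAffinePoints K ∅ ![2 ^ r, 2]) = 2 ^ (r + 1) := by
  rw [← Nat.card_congr (sumEquivPoints hK), Nat.card_sum, hK, pow_succ, mul_two]

/-- The restriction of a word to the line `y = 1`. -/
noncomputable def upperHalf (hK : Nat.card K = 2 ^ r) :
    (jAffinePoints K ∅ ![2 ^ r, 2] → ZMod 2) →ₗ[ZMod 2] (K → ZMod 2) :=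
  LinearMap.funLeft _ _ fun x => sumEquivPoints hK (Sum.inr x)

/-- The sum of the restrictions of a word to the lines `y = 0` and `y = 1`. -/
noncomputable def sumHalves (hK : Nat.card K = 2 ^ r) :
    (jAffinePoints K ∅ ![2 ^ r, 2] → ZMod 2) →ₗ[ZMod 2] (K → ZMod 2) :=
  LinearMap.funLeft _ _ (fun x => sumEquivPoints hK (Sum.inl x)) + upperHalf hK

theorem hammingNorm_points (hK : Nat.card K = 2 ^ r)
    (c : jAffinePoints K ∅ ![2 ^ r, 2] → ZMod 2) :
    hammingNorm c = hammingNorm (fun x => c (sumEquivPoints hK (Sum.inl x))) +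
      hammingNorm (upperHalf hK c) := by
  simp only [hammingNorm, Finset.card_filter]
  rw [← (sumEquivPoints hK).sum_comp, Fintype.sum_sum_type]
  rfl

/-- The weights in the `(u | u + v)` construction. -/
theorem min_le_hammingNorm_points (hK : Nat.card K = 2 ^ r)
    {c : jAffinePoints K ∅ ![2 ^ r, 2] → ZMod 2} (hc : c ≠ 0) {d : ℕ}
    (hs : sumHalves hK c ≠ 0 → 2 * d ≤ hammingNorm (sumHalves hK c))
    (hu : upperHalf hK c ≠ 0 → d ≤ hammingNorm (upperHalf hK c)) : 2 * d ≤ hammingNorm c := by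
  rw [hammingNorm_points hK c]
  -- If the halves coincide, the weight is twice that of one half. Otherwise it is at least the
  -- weight of their sum, by the triangle inequality.
  by_cases h : sumHalves hK c = 0
  · have heq : (fun x => c (sumEquivPoints hK (Sum.inl x))) = upperHalf hK c := by
      funext x
      exact CharTwo.add_eq_zero.1 (congrFun h x)
    have hne : upperHalf hK c ≠ 0 := by
      intro h0
      refine hc (funext fun P => ?_)
      obtain ⟨x | x, rfl⟩ := (sumEquivPoints hK).surjective P
      · exact congrFun (heq.trans h0) x
      · exact congrFun h0 x
    have := hu hne
    rw [heq]
    omega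
  · have h1 := hs h
    have hneg (f : K → ZMod 2) : -f = f := funext fun x => CharTwo.neg_eq (f x)
    have h2 := hammingDist_triangle (fun x => c (sumEquivPoints hK (Sum.inl x))) 0
      (upperHalf hK c)
    rw [hammingDist_zero_right, hammingDist_zero_left, hammingDist_eq_hammingNorm, hneg] at h2
    exact h1.trans h2

variable [Algebra (ZMod 2) K]

/-- `X ^ a` takes the same values on both lines, so only the sum of the halves matters; the factor
`Y` in the next lemma kills the line `y = 0`. -/
theorem sum_mul_evalMonomial_zero (hK : Nat.card K = 2 ^ r)
    (c : jAffinePoints K ∅ ![2 ^ r, 2] → ZMod 2) (a : ℕ) :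
    ∑ P, algebraMap (ZMod 2) K (c P) * evalMonomial
        (fun P : jAffinePoints K ∅ ![2 ^ r, 2] => (P : Fin 2 → K)) ![a, 0] P =
      moment (ZMod 2) K a (sumHalves hK c) := by
  rw [← (sumEquivPoints hK).sum_comp, Fintype.sum_sum_type, moment_apply, ← Finset.sum_add_distrib]
  refine Finset.sum_congr rfl fun x _ => ?_
  simp [evalMonomial, sumEquivPoints_inl, sumEquivPoints_inr, sumHalves, upperHalf,
    LinearMap.funLeft_apply, add_mul]

theorem sum_mul_evalMonomial_one (hK : Nat.card K = 2 ^ r)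
    (c : jAffinePoints K ∅ ![2 ^ r, 2] → ZMod 2) (a : ℕ) :
    ∑ P, algebraMap (ZMod 2) K (c P) * evalMonomial
        (fun P : jAffinePoints K ∅ ![2 ^ r, 2] => (P : Fin 2 → K)) ![a, 1] P =
      moment (ZMod 2) K a (upperHalf hK c) := by
  rw [← (sumEquivPoints hK).sum_comp, Fintype.sum_sum_type, moment_apply, ← Finset.sum_add_distrib]
  refine Finset.sum_congr rfl fun x _ => ?_
  simp [evalMonomial, sumEquivPoints_inl, sumEquivPoints_inr, upperHalf, LinearMap.funLeft_apply]

/-- The word which is the indicator function of `T` on both lines. -/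
theorem exists_word_of_finset [DecidableEq K] (hK : Nat.card K = 2 ^ r) (T : Finset K) :
    ∃ c, sumHalves hK c = 0 ∧ hammingNorm c = 2 * T.card ∧
      ∀ i, moment (ZMod 2) K i (upperHalf hK c) = ∑ x ∈ T, x ^ i := by
  let f : K → ZMod 2 := fun x => if x ∈ T then 1 else 0
  let c := Sum.elim f f ∘ (sumEquivPoints hK).symm
  have hl : (fun x => c (sumEquivPoints hK (Sum.inl x))) = f := by ext x; simp [c]
  have hu : upperHalf hK c = f := by ext x; simp [c, upperHalf, LinearMap.funLeft_apply]
  refine ⟨c, ?_, ?_, fun i => ?_⟩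
  · ext x
    rw [sumHalves, LinearMap.add_apply, hu, Pi.add_apply, ← hl]
    exact CharTwo.add_self_eq_zero _
  · rw [hammingNorm_points hK, hl, hu, ← two_mul]
    congr 1
    simp [hammingNorm, f]
  · rw [hu, moment_apply]
    simp [f]

theorem mem_dualCode_binCode_iff (A : Set (Fin 2 → ℕ))
    (c : jAffinePoints K ∅ ![2 ^ r, 2] → ZMod 2) :
    c ∈ dualCode (binCode K r (⋃ a ∈ A, cyclotomicSet 2 ∅ ![2 ^ r, 2] a)) ↔
      ∀ a ∈ A, ∑ P, algebraMap (ZMod 2) K (c P) *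
        evalMonomial (fun P : jAffinePoints K ∅ ![2 ^ r, 2] => (P : Fin 2 → K)) a P = 0 := by
  have h := mem_dualCode_subfieldSubcode_iff (k := ZMod 2) A c
  rw [nat_card_zmod_two] at h
  exact h

theorem mem_dualCode_three_iff (hK : Nat.card K = 2 ^ r)
    (c : jAffinePoints K ∅ ![2 ^ r, 2] → ZMod 2) :
    c ∈ dualCode (binCode K r (binCoset r 0 0 ∪ binCoset r 1 0 ∪ binCoset r 0 1)) ↔
      moment (ZMod 2) K 0 (sumHalves hK c) = 0 ∧ moment (ZMod 2) K 0 (upperHalf hK c) = 0 ∧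
        moment (ZMod 2) K 1 (sumHalves hK c) = 0 := by
  have h : binCoset r 0 0 ∪ binCoset r 1 0 ∪ binCoset r 0 1 =
      ⋃ a ∈ ({![0, 0], ![1, 0], ![0, 1]} : Set (Fin 2 → ℕ)),
        cyclotomicSet 2 ∅ ![2 ^ r, 2] a := by
    simp only [Set.biUnion_insert, Set.biUnion_singleton, binCoset, Set.union_assoc]
  rw [h, mem_dualCode_binCode_iff]
  simp only [Set.mem_insert_iff, Set.mem_singleton_iff, forall_eq_or_imp, forall_eq,
    sum_mul_evalMonomial_zero hK, sum_mul_evalMonomial_one hK]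
  tauto

theorem mem_dualCode_six_iff (hK : Nat.card K = 2 ^ r)
    (c : jAffinePoints K ∅ ![2 ^ r, 2] → ZMod 2) :
    c ∈ dualCode (binCode K r (binCoset r 0 0 ∪ binCoset r 0 1 ∪ binCoset r 1 1 ∪
        binCoset r 1 0 ∪ binCoset r 3 0 ∪ binCoset r 5 0)) ↔
      moment (ZMod 2) K 0 (sumHalves hK c) = 0 ∧ moment (ZMod 2) K 0 (upperHalf hK c) = 0 ∧
        moment (ZMod 2) K 1 (upperHalf hK c) = 0 ∧ moment (ZMod 2) K 1 (sumHalves hK c) = 0 ∧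
        moment (ZMod 2) K 3 (sumHalves hK c) = 0 ∧ moment (ZMod 2) K 5 (sumHalves hK c) = 0 := by
  have h : binCoset r 0 0 ∪ binCoset r 0 1 ∪ binCoset r 1 1 ∪ binCoset r 1 0 ∪ binCoset r 3 0 ∪
        binCoset r 5 0 =
      ⋃ a ∈ ({![0, 0], ![0, 1], ![1, 1], ![1, 0], ![3, 0], ![5, 0]} : Set (Fin 2 → ℕ)),
        cyclotomicSet 2 ∅ ![2 ^ r, 2] a := by
    simp only [Set.biUnion_insert, Set.biUnion_singleton, binCoset, Set.union_assoc]
  rw [h, mem_dualCode_binCode_iff]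
  simp only [Set.mem_insert_iff, Set.mem_singleton_iff, forall_eq_or_imp, forall_eq,
    sum_mul_evalMonomial_zero hK, sum_mul_evalMonomial_one hK]

/-- The dimension of `D` is the codimension of its dual, hence at most the rank of any system of
equations that forces membership in the dual. -/
theorem finrank_le_of_ker_le_dualCode {F ι V : Type*} [Field F] [Fintype ι] [AddCommGroup V]
    [Module F V] [FiniteDimensional F V] {D : Submodule F (ι → F)} (L : (ι → F) →ₗ[F] V)
    (h : LinearMap.ker L ≤ dualCode D) : Module.finrank F D ≤ Module.finrank F V := by
  have h1 := LinearMap.finrank_range_add_finrank_ker L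
  have h2 := Submodule.finrank_mono h
  have h3 := (LinearMap.range L).finrank_le
  have h4 := finrank_add_finrank_dualCode D
  rw [Module.finrank_pi] at h1
  omega

theorem finrank_zmod_two (hK : Nat.card K = 2 ^ r) : Module.finrank (ZMod 2) K = r := by
  have h := Module.card_eq_pow_finrank (K := ZMod 2) (V := K)
  rw [← Nat.card_eq_fintype_card, hK, ZMod.card] at h
  exact (Nat.pow_right_injective le_rfl h).symm

theorem finrank_three_le (hK : Nat.card K = 2 ^ r) :
    Module.finrank (ZMod 2) (binCode K r (binCoset r 0 0 ∪ binCoset r 1 0 ∪ binCoset r 0 1)) ≤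
      r + 2 := by
  -- Zeroth moments are taken in `𝔽₂` rather than in `K`, so each costs one dimension instead of
  -- `r`.
  let σ : (K → ZMod 2) →ₗ[ZMod 2] ZMod 2 := Fintype.linearCombination (ZMod 2) fun _ => 1
  have hσ (f : K → ZMod 2) : σ f = ∑ x, f x := by simp [σ, Fintype.linearCombination_apply]
  have := finrank_le_of_ker_le_dualCode
    (D := binCode K r (binCoset r 0 0 ∪ binCoset r 1 0 ∪ binCoset r 0 1))
    ((σ ∘ₗ sumHalves hK).prod ((σ ∘ₗ upperHalf hK).prod (moment (ZMod 2) K 1 ∘ₗ sumHalves hK)))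
    fun c hc => by
      rw [mem_dualCode_three_iff hK, moment_zero_eq_zero_iff, moment_zero_eq_zero_iff]
      simpa [hσ] using hc
  simp only [Module.finrank_prod, Module.finrank_self, finrank_zmod_two hK] at this
  omega

theorem finrank_six_le (hK : Nat.card K = 2 ^ r) :
    Module.finrank (ZMod 2) (binCode K r (binCoset r 0 0 ∪ binCoset r 0 1 ∪ binCoset r 1 1 ∪
        binCoset r 1 0 ∪ binCoset r 3 0 ∪ binCoset r 5 0)) ≤ 4 * r + 2 := by
  let σ : (K → ZMod 2) →ₗ[ZMod 2] ZMod 2 := Fintype.linearCombination (ZMod 2) fun _ => 1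
  have hσ (f : K → ZMod 2) : σ f = ∑ x, f x := by simp [σ, Fintype.linearCombination_apply]
  have := finrank_le_of_ker_le_dualCode
    (D := binCode K r (binCoset r 0 0 ∪ binCoset r 0 1 ∪ binCoset r 1 1 ∪
        binCoset r 1 0 ∪ binCoset r 3 0 ∪ binCoset r 5 0))
    ((σ ∘ₗ sumHalves hK).prod ((σ ∘ₗ upperHalf hK).prod
      ((moment (ZMod 2) K 1 ∘ₗ upperHalf hK).prod ((moment (ZMod 2) K 1 ∘ₗ sumHalves hK).prod
        ((moment (ZMod 2) K 3 ∘ₗ sumHalves hK).prod (moment (ZMod 2) K 5 ∘ₗ sumHalves hK))))))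
    fun c hc => by
      rw [mem_dualCode_six_iff hK, moment_zero_eq_zero_iff, moment_zero_eq_zero_iff]
      simpa [hσ] using hc
  simp only [Module.finrank_prod, Module.finrank_self, finrank_zmod_two hK] at this
  omega

theorem moment_two_mul_eq_zero {i : ℕ} {f : K → ZMod 2} (h : moment (ZMod 2) K i f = 0) :
    moment (ZMod 2) K (2 * i) f = 0 := by
  have := moment_card_mul_eq_zero h
  rwa [nat_card_zmod_two] at this

theorem lt_hammingNorm_of_moment_zero_one {f : K → ZMod 2} (hf : f ≠ 0)
    (h0 : moment (ZMod 2) K 0 f = 0) (h1 : moment (ZMod 2) K 1 f = 0) : 3 < hammingNorm f :=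
  lt_hammingNorm_of_moment_eq_zero hf fun i hi => by
    interval_cases i
    · exact h0
    · exact h1
    · exact moment_two_mul_eq_zero h1

theorem hasMinDist_dualCode_three (hK : Nat.card K = 2 ^ r) :
    HasMinDist (dualCode (binCode K r (binCoset r 0 0 ∪ binCoset r 1 0 ∪ binCoset r 0 1))) 4 := by
  classical
  have : CharP K 2 := charP_of_injective_algebraMap (algebraMap (ZMod 2) K).injective 2
  constructor
  -- Doubling a word makes the sum of its halves zero; the upper half then only needs even weight.
  · obtain ⟨c, hs, hw, hm⟩ := exists_word_of_finset hK ({0, 1} : Finset K)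
    rw [Finset.card_pair zero_ne_one] at hw
    refine ⟨c, (mem_dualCode_three_iff hK c).2 ⟨?_, ?_, ?_⟩, ?_, hw⟩
    · rw [hs, map_zero]
    · rw [hm, Finset.sum_pair zero_ne_one]
      simpa using CharTwo.add_self_eq_zero (1 : K)
    · rw [hs, map_zero]
    · rintro rfl
      simp at hw
  · rintro _ ⟨c, hc, h0, rfl⟩
    obtain ⟨hs0, hu0, hs1⟩ := (mem_dualCode_three_iff hK c).1 hc
    refine min_le_hammingNorm_points hK h0 (d := 2)
      (fun hs => lt_hammingNorm_of_moment_zero_one hs hs0 hs1)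
      (fun hu => lt_hammingNorm_of_moment_eq_zero hu (d := 1) fun i hi => ?_)
    rwa [Nat.lt_one_iff.1 hi]

theorem hasMinDist_dualCode_six (hK : Nat.card K = 2 ^ r) (hr : 2 ≤ r) :
    HasMinDist (dualCode (binCode K r (binCoset r 0 0 ∪ binCoset r 0 1 ∪ binCoset r 1 1 ∪
      binCoset r 1 0 ∪ binCoset r 3 0 ∪ binCoset r 5 0))) 8 := by
  classical
  have : CharP K 2 := charP_of_injective_algebraMap (algebraMap (ZMod 2) K).injective 2
  constructor
  -- For `r ≥ 2` there is an `𝔽₂`-plane `{0, 1, a, a + 1}` in `K`. It has even size and sum zero, so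
  -- its doubled indicator is a dual word of weight 8.
  · obtain ⟨a, ha⟩ : ∃ a : K, a ∉ ({0, 1} : Finset K) := by
      by_contra! h
      have h1 := Finset.card_le_card fun x (_ : x ∈ Finset.univ) => h x
      rw [Finset.card_univ, ← Nat.card_eq_fintype_card, hK, Finset.card_pair zero_ne_one] at h1
      have h2 := Nat.pow_le_pow_right two_pos hr
      omega
    simp only [Finset.mem_insert, Finset.mem_singleton, not_or] at ha
    have ha1 : a + 1 ≠ 0 := fun h => ha.2 (CharTwo.add_eq_zero.1 h)
    have hn1 : a ∉ ({a + 1} : Finset K) := by simp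
    have hn2 : (1 : K) ∉ ({a, a + 1} : Finset K) := by simp [ha.1, Ne.symm ha.2]
    have hn3 : (0 : K) ∉ ({1, a, a + 1} : Finset K) := by simp [Ne.symm ha.1, ha1.symm]
    have hsum (i : ℕ) : ∑ x ∈ ({0, 1, a, a + 1} : Finset K), x ^ i =
        0 ^ i + (1 ^ i + (a ^ i + (a + 1) ^ i)) := by
      rw [Finset.sum_insert hn3, Finset.sum_insert hn2, Finset.sum_insert hn1,
        Finset.sum_singleton]
    have h2 : (2 : K) = 0 := CharTwo.two_eq_zero
    obtain ⟨c, hs, hw, hm⟩ := exists_word_of_finset hK ({0, 1, a, a + 1} : Finset K)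
    rw [Finset.card_insert_of_notMem hn3, Finset.card_insert_of_notMem hn2,
      Finset.card_insert_of_notMem hn1, Finset.card_singleton] at hw
    refine ⟨c, (mem_dualCode_six_iff hK c).2 ?_, ?_, hw⟩
    · simp only [hs, map_zero, hm, hsum, true_and, and_true]
      constructor
      · linear_combination 2 * h2
      · linear_combination (a + 1) * h2
    · rintro rfl
      simp at hw
  · rintro _ ⟨c, hc, h0, rfl⟩
    obtain ⟨hs0, hu0, hu1, hs1, hs3, hs5⟩ := (mem_dualCode_six_iff hK c).1 hc
    refine min_le_hammingNorm_points hK h0 (d := 4)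
      (fun hs => lt_hammingNorm_of_moment_eq_zero hs (d := 7) fun i hi => ?_)
      (fun hu => lt_hammingNorm_of_moment_zero_one hu hu0 hu1)
    -- Moments 0, 1, 3, 5 vanish by assumption; squaring gives 2 and 4 from 1, and 6 from 3.
    interval_cases i
    · exact hs0
    · exact hs1
    · exact moment_two_mul_eq_zero hs1
    · exact hs3
    · exact moment_two_mul_eq_zero (moment_two_mul_eq_zero hs1)
    · exact hs5
    · exact moment_two_mul_eq_zero hs3

theorem binCode_zero (hK : Nat.card K = 2 ^ r) :
    binCode K r (binCoset r 0 0) = Submodule.span (ZMod 2) {fun _ => 1} := by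
  have h : binCoset r 0 0 = {fun _ => 0} := by
    ext e
    simp only [binCoset, cyclotomicSet, Set.mem_range, Set.mem_singleton_iff]
    have : ∀ i : ℕ, reduceExponent ∅ ![2 ^ r, 2] (fun j => 2 ^ i * ![0, 0] j) = fun _ => 0 := by
      intro i
      ext j
      fin_cases j <;> simp [reduceExponent]
    simp only [this, exists_const, eq_comm]
  have hev : evalMonomial (fun P : jAffinePoints K ∅ ![2 ^ r, 2] => (P : Fin 2 → K))
      (fun _ => 0) = fun _ => 1 := by
    ext P
    simp [evalMonomial]
  ext c
  rw [binCode, h, subfieldSubcode, Submodule.mem_comap, Submodule.restrictScalars_mem,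
    jAffineCode, monomialCode, Set.image_singleton, hev, Submodule.mem_span_singleton,
    Submodule.mem_span_singleton]
  constructor
  · rintro ⟨β, hβ⟩
    -- A constant word over `K` with binary entries has its constant in `𝔽₂`, which can be read off
    -- at any point.
    let P₀ := sumEquivPoints hK (Sum.inl 0)
    refine ⟨c P₀, funext fun P => (algebraMap (ZMod 2) K).injective ?_⟩
    have h1 := congrFun hβ P₀
    have h2 := congrFun hβ P
    simp only [Pi.smul_apply, smul_eq_mul, mul_one, LinearMap.compLeft_apply, Function.comp_apply,
      Algebra.linearMap_apply] at h1 h2 ⊢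
    rw [← h1, ← h2]
  · rintro ⟨a, rfl⟩
    exact ⟨algebraMap (ZMod 2) K a, by ext P; simp⟩

end BinaryCodes

/-! ### Assembly of dimensions, distances and rates. -/

theorem mainTheorem11 (r : ℕ) (hr : 1 ≤ r) (K : Type*) [Field K] [Finite K]
    [Algebra (ZMod 2) K] (hK : Nat.card K = 2 ^ r)
    (C DA DB : Submodule (ZMod 2) (jAffinePoints K ∅ ![2 ^ r, 2] → ZMod 2))
    (hC : C = binCode K r (binCoset r 0 0))
    (hDA : DA = binCode K r (binCoset r 0 0 ∪ binCoset r 1 0 ∪ binCoset r 0 1))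
    (hDB : DB = binCode K r (binCoset r 0 0 ∪ binCoset r 0 1 ∪ binCoset r 1 1 ∪
      binCoset r 1 0 ∪ binCoset r 3 0 ∪ binCoset r 5 0))
    (n b : ℕ) (hn : n = Nat.card (jAffinePoints K ∅ ![2 ^ r, 2]))
    (hb : b = (r + 1).choose 0 + (r + 1).choose 1 + (r + 1).choose 2) :
    -- the storage code is the repetition code of length `2 ^ (r + 1)`
    (n = 2 ^ (r + 1) ∧ C = Submodule.span (ZMod 2) {fun _ => 1} ∧
      Module.finrank (ZMod 2) C = 1) ∧
    -- part (a)
    (HasMinDist (dualCode DA) 4 ∧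
      (∃ S : SchurScheme C DA, ∀ M : ℕ, (S.toPIR M).ResistsCollusion 3 ∧
        (S.toPIR M).rate = ((n : ℚ) - (r + 2)) / n) ∧
      dualCode (reedMuller (ZMod 2) 1 (r + 1)) = reedMuller (ZMod 2) (r - 1) (r + 1) ∧
      HasMinDist (dualCode (reedMuller (ZMod 2) 1 (r + 1))) 4 ∧
      (∃ S : SchurScheme (reedMuller (ZMod 2) 0 (r + 1)) (reedMuller (ZMod 2) 1 (r + 1)),
        ∀ M : ℕ, (S.toPIR M).ResistsCollusion 3 ∧
          (S.toPIR M).rate = ((n : ℚ) - (r + 2)) / n)) ∧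
    -- part (b); for `r = 1` the code is the whole space, and its dual is zero
    (2 ≤ r →
      Module.finrank (ZMod 2) DB ≤ 4 * r + 2 ∧
      HasMinDist (dualCode DB) 8 ∧
      (∃ S : SchurScheme C DB,
        (∀ M : ℕ, (S.toPIR M).ResistsCollusion 7 ∧
          (S.toPIR M).rate = (Module.finrank (ZMod 2) (dualCode (starProduct C DB)) : ℚ) / n ∧
          ((n : ℚ) - (4 * r + 2)) / n ≤ (S.toPIR M).rate) ∧
        -- the rate beats that of every Schur product scheme for the Reed–Muller pair
        (4 * r + 2 < b →
          ∀ S' : SchurScheme (reedMuller (ZMod 2) 0 (r + 1)) (reedMuller (ZMod 2) 2 (r + 1)),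
            ∀ M : ℕ, (S'.toPIR M).rate < (S.toPIR M).rate)) ∧
      HasMinDist (dualCode (reedMuller (ZMod 2) 2 (r + 1))) 8 ∧
      Module.finrank (ZMod 2) (reedMuller (ZMod 2) 2 (r + 1)) = b ∧
      (∃ S' : SchurScheme (reedMuller (ZMod 2) 0 (r + 1)) (reedMuller (ZMod 2) 2 (r + 1)),
        ∀ M : ℕ, (S'.toPIR M).ResistsCollusion 7 ∧ (S'.toPIR M).rate = ((n : ℚ) - b) / n) ∧
      (5 < r → 4 * r + 2 < b)) := by
  have : Fintype K := Fintype.ofFinite K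
  have hcardZ := card_points hK
  have hcard : Fintype.card (jAffinePoints K ∅ ![2 ^ r, 2]) = 2 ^ (r + 1) := by
    rw [← Nat.card_eq_fintype_card, hcardZ]
  have hcardR : Fintype.card (Fin (r + 1) → ZMod 2) = 2 ^ (r + 1) := by simp
  have : Nonempty (jAffinePoints K ∅ ![2 ^ r, 2]) := ⟨sumEquivPoints hK (Sum.inl 0)⟩
  have hpow : r + 2 ≤ 2 ^ (r + 1) := Nat.lt_two_pow_self
  have hq : ((2 ^ (r + 1) : ℕ) : ℚ) - (r + 2) = ((2 ^ (r + 1) - (r + 2) : ℕ) : ℚ) := by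
    rw [Nat.cast_sub hpow]
    push_cast
    rfl
  rw [binCode_zero hK] at hC
  rw [hcardZ] at hn
  have hA := hasMinDist_dualCode_three hK
  have hA' := hasMinDist_dualCode_reedMuller (s := 1) (m := r + 1) (by omega)
  have hAr : Module.finrank (ZMod 2) (reedMuller (ZMod 2) 1 (r + 1)) = r + 2 := by
    rw [finrank_reedMuller]
    simp [Finset.sum_range_succ]
    omega
  rw [← hDA] at hA
  subst hn hC
  refine ⟨⟨rfl, rfl, finrank_span_one⟩, ⟨hA, ?_, dualCode_reedMuller (by omega), hA', ?_⟩, ?_⟩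
  · have h := finrank_three_le hK
    rw [← hDA] at h
    rw [hq, ← hcard]
    exact exists_schurScheme_span_one_rate (by omega) fun x hx h0 => hA.2 ⟨x, hx, h0, rfl⟩
  · rw [hq, reedMuller_zero, ← hcardR]
    exact exists_schurScheme_span_one_rate (by omega) fun x hx h0 => hA'.2 ⟨x, hx, h0, rfl⟩
  intro hr2
  have hBle := finrank_six_le hK
  have hB := hasMinDist_dualCode_six hK hr2
  have hB' := hasMinDist_dualCode_reedMuller (s := 2) (m := r + 1) (by omega)
  have hBr : Module.finrank (ZMod 2) (reedMuller (ZMod 2) 2 (r + 1)) = b := by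
    rw [finrank_reedMuller, hb]
    simp [Finset.sum_range_succ]
  rw [← hDB] at hB hBle
  have hdual := finrank_add_finrank_dualCode DB
  have hdual' := finrank_add_finrank_dualCode (reedMuller (ZMod 2) 2 (r + 1))
  rw [hcard] at hdual
  rw [hcardR, hBr] at hdual'
  have hnpos : (0 : ℚ) < (2 ^ (r + 1) : ℕ) := by positivity
  refine ⟨hBle, hB, ?_, hB', hBr, ?_, ?_⟩
  -- Here `k` is the largest possible, `n - dim DB`, since the exact dimension of the dual is wanted
  -- in the rate.
  · obtain ⟨S, hS⟩ := exists_schurScheme_span_one_rate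
      (D := DB) (k := Module.finrank (ZMod 2) (dualCode DB)) (t := 7) (by omega)
      fun x hx h0 => hB.2 ⟨x, hx, h0, rfl⟩
    rw [hcard] at hS
    have hge : (((2 ^ (r + 1) : ℕ) : ℚ) - (4 * r + 2)) / (2 ^ (r + 1) : ℕ) ≤
        (Module.finrank (ZMod 2) (dualCode DB) : ℚ) / (2 ^ (r + 1) : ℕ) := by
      refine div_le_div_of_nonneg_right ?_ hnpos.le
      rw [sub_le_iff_le_add]
      exact_mod_cast (by omega)
    refine ⟨S, fun M => ⟨(hS M).1, ?_, ?_⟩, fun hlt S' M => ?_⟩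
    · rw [(hS M).2, starProduct_span_one]
    · rw [(hS M).2]
      exact hge
    · have hstar : starProduct (reedMuller (ZMod 2) 0 (r + 1)) (reedMuller (ZMod 2) 2 (r + 1)) =
          reedMuller (ZMod 2) 2 (r + 1) := by rw [reedMuller_zero, starProduct_span_one]
      have h := S'.rate_toPIR_le M
      rw [hstar, hBr, hcardR] at h
      rw [(hS M).2]
      -- Any Reed–Muller scheme has rate at most `(n - b) / n`, which is below `(n - (4r + 2)) / n`.
      refine h.trans_lt (lt_of_lt_of_le (div_lt_div_of_pos_right ?_ hnpos) hge)
      have : (4 * r + 2 : ℚ) < b := by exact_mod_cast hlt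
      linarith
  · rw [reedMuller_zero]
    have hq' : ((2 ^ (r + 1) : ℕ) : ℚ) - b = ((2 ^ (r + 1) - b : ℕ) : ℚ) := by
      rw [Nat.cast_sub (by omega)]
    rw [hq', ← hcardR]
    exact exists_schurScheme_span_one_rate (by omega) fun x hx h0 => hB'.2 ⟨x, hx, h0, rfl⟩
  · intro hr5
    -- The inequality becomes `r (r + 1) / 2 > 3 r`, which for positive `r` means exactly `r > 5`.
    have h2 : (r + 1).choose 2 * 2 = (r + 1) * r := by
      rw [Nat.choose_two_right, Nat.add_sub_cancel]
      exact Nat.div_mul_cancel (by rw [mul_comm]; exact (Nat.even_mul_succ_self r).two_dvd)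
    rw [hb, Nat.choose_zero_right, Nat.choose_one_right]
    nlinarith
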